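/- For finite sets $X,Y\subset\mathbb R$, let the multiplicative energy $E^\times(X,Y)$ be the number of quadruples $(x_1,x_2,y_1,y_2)\in X\times X\times Y\times Y$ with $x_1y_1=x_2y_2$, and write $E^\times(X)=E^\times(X,X)$. Write $X\pm t=\{x\pm t:x\in X\}$ and $XY=\{xy:x\in X,\ y\in Y\}$. All logarithms are to base $2$. (i) For every $K>0$ there is a constant $c_K>0$, depending only on $K$, such that for all finite sets $A,B,C\subset\mathbb R$ with $|A|\le K|C|$ and $|C|\le K|A|$, $$\sum_{a\in A}E^\times(B,C-a)\le c_K\left(E^\times(B)^{1/2}|A|^2\log^{1/2}|A|+|A|^3+|A||B|^2\right)$$ (where for $A=\emptyset$ both sides are read as $0$). (ii) There is an absolute constant $c>0$ such that for every finite set $A\subset\mathbb R$ with $|A|\ge2$ there exists $a\in A$ with $$E^\times(A)\,|A(A+a)|^2\ge c\,\frac{|A|^6}{\log|A|},$$ and similarly there exists $b\in A$ with $$E^\times(A)\,|A(A-b)|^2\ge c\,\frac{|A|^6}{\log|A|}.$$ -/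

import Mathlib

open scoped Pointwise

/-!
Both parts rest on a bound for collinear triples in a Cartesian grid. Apart from quadruples with
vanishing products, which contribute at most `|A| (|B| + |C|) ^ 2`, the sum of energies in the first
part counts the solutions of
`b₁ / b₂ = (c₂ - a) / (c₁ - a)`, so by Cauchy–Schwarz its square is at most `E(B)` times the number
of pairs of triples `(a, c₁, c₂)`, `(a', c₁', c₂')` with equal ratios. Equality of ratios
says that the points `(a, a')`, `(c₁, c₁')`, `(c₂, c₂')` of `D × D`, where `D = A ∪ C`, lie on a
common line that is neither vertical nor horizontal. With `N = |D|` and `m l` the number of points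
on the line `l`, it suffices to show `∑ l, m l ^ 3 ≪ N ^ 4 log N`
(`sum_card_gridPoints_cube_le`).

For a Cartesian grid this does not need the full Szemerédi–Trotter theorem. Cut `D` into `r` blocks
of about `N / r` consecutive elements (`exists_monotone_blocks`), and hence the plane into `r ^ 2`
cells. Being monotone, a line meets at most `2 r` cells, so by Cauchy–Schwarz a line with
`m ≥ 4 r` points has at least `m ^ 2 / (4 r)` ordered pairs of distinct points in a common cell
(`sq_card_gridPoints_le`). Two distinct points determine their line, so over all lines there are at
most `4 N ^ 4 / r ^ 2` such pairs (`sum_card_sameCellPairs_le`). Weighting by `r` and summing over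
`r ≤ N` turns the lower bound into `m ^ 3` up to a constant and the upper bound into `N ^ 4` times
a harmonic sum.

For the pinned bounds, Cauchy–Schwarz gives `|A| ^ 4 ≤ |A (A - t)| E(A, A - t)`; summing over `t` in
`A` or in `-A` and inserting the first part bounds the largest `|A (A - t)|` from below
(`exists_mem_le_mulEnergy_mul_card_sq`).
-/

open Finset

/-! ### Counting collisions -/

theorem card_filter_eq_sum_card_mul_card {α β γ : Type*} [DecidableEq γ] (S : Finset α)
    (T : Finset β) (f : α → γ) (g : β → γ) (I : Finset γ) (hI : ∀ s ∈ S, f s ∈ I) :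
    #{p ∈ S ×ˢ T | f p.1 = g p.2} = ∑ i ∈ I, #{s ∈ S | f s = i} * #{t ∈ T | g t = i} := by
  rw [card_eq_sum_card_fiberwise (f := fun p => f p.1) (t := I)]
  · refine sum_congr rfl fun i _ => ?_
    rw [← card_product]
    congr 1
    ext ⟨s, t⟩
    simp only [mem_filter, mem_product]
    grind
  · intro p hp
    simp only [coe_filter, mem_product, Set.mem_ofPred_eq] at hp
    exact hI _ hp.1.1

/-- The Cauchy–Schwarz inequality for the representation functions of `f` and `g`. -/
theorem sq_card_filter_eq_le {α β γ : Type*} [DecidableEq γ] (S : Finset α) (T : Finset β)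
    (f : α → γ) (g : β → γ) :
    #{p ∈ S ×ˢ T | f p.1 = g p.2} ^ 2 ≤
      #{p ∈ S ×ˢ S | f p.1 = f p.2} * #{p ∈ T ×ˢ T | g p.1 = g p.2} := by
  have hS : ∀ s ∈ S, f s ∈ S.image f ∪ T.image g := fun s hs =>
    mem_union_left _ (mem_image_of_mem f hs)
  have hT : ∀ t ∈ T, g t ∈ S.image f ∪ T.image g := fun t ht =>
    mem_union_right _ (mem_image_of_mem g ht)
  rw [card_filter_eq_sum_card_mul_card S T f g _ hS, card_filter_eq_sum_card_mul_card S S f f _ hS,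
    card_filter_eq_sum_card_mul_card T T g g _ hT]
  simpa only [sq] using sum_mul_sq_le_sq_mul_sq (S.image f ∪ T.image g)
    (fun i => #{s ∈ S | f s = i}) (fun i => #{t ∈ T | g t = i})

theorem sq_card_le_card_mul_card_filter_eq {α γ : Type*} [DecidableEq γ] (S : Finset α)
    (f : α → γ) (I : Finset γ) (hI : ∀ s ∈ S, f s ∈ I) :
    #S ^ 2 ≤ #I * #{p ∈ S ×ˢ S | f p.1 = f p.2} := by
  have h := sq_card_filter_eq_le S I f id
  have h1 : #{p ∈ S ×ˢ I | f p.1 = id p.2} = #S := by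
    rw [card_filter_eq_sum_card_mul_card S I f id I hI,
      card_eq_sum_card_fiberwise (s := S) (f := f) (t := I) (fun s hs => hI s hs)]
    refine sum_congr rfl fun i hi => ?_
    have : {t ∈ I | id t = i} = {i} := by
      ext t
      simp only [id_eq, mem_filter, mem_singleton]
      exact ⟨And.right, fun h => ⟨h ▸ hi, h⟩⟩
    rw [this, card_singleton, mul_one]
  have h2 : #{p ∈ I ×ˢ I | id p.1 = id p.2} = #I := by
    rw [← diag_card I]
    congr 1
    ext ⟨x, y⟩
    simp only [id_eq, mem_filter, mem_product, mem_diag]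
    exact ⟨fun h => ⟨h.1.1, h.2⟩, fun h => ⟨⟨h.1, h.2 ▸ h.1⟩, h.2⟩⟩
  rw [h1, h2] at h
  linarith

/-! ### Cutting a finite set of reals into blocks -/

/-- `D` can be cut into at most `r` blocks of consecutive elements, of size at most `2 |D| / r`,
given here as the fibres of a monotone function. Only the resulting bound for the number of pairs
in a common block is recorded. -/
theorem exists_monotone_blocks (D : Finset ℝ) (r : ℕ) (hr : 1 ≤ r) (hrD : r ≤ #D) :
    ∃ β : ℝ → ℕ, Monotone β ∧ (∀ x ∈ D, β x < r) ∧
      r * #{p ∈ D ×ˢ D | β p.1 = β p.2} ≤ 2 * #D ^ 2 := by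
  obtain ⟨q, hq, hq1, hq2⟩ : ∃ q, 0 < q ∧ #D ≤ r * q ∧ r * q ≤ 2 * #D := by
    refine ⟨#D / r + 1, Nat.succ_pos _, ?_, ?_⟩
    · exact (Nat.lt_mul_div_succ _ hr).le
    · have := Nat.mul_div_le #D r
      rw [mul_add, mul_one]; omega
  -- `ρ` is the rank in `D`; a block consists of `q` consecutive ranks.
  set ρ : ℝ → ℕ := fun x => #{y ∈ D | y < x} with hρ
  have hmono : Monotone ρ := fun x y hxy =>
    card_le_card fun z hz => by
      simp only [mem_filter] at hz ⊢
      exact ⟨hz.1, hz.2.trans_le hxy⟩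
  have hstrict : ∀ x ∈ D, ∀ y, x < y → ρ x < ρ y := fun x hx y hxy =>
    card_lt_card ⟨fun z hz => by
      simp only [mem_filter] at hz ⊢
      exact ⟨hz.1, hz.2.trans hxy⟩, fun h => by
      have := h (mem_filter.2 ⟨hx, hxy⟩)
      simp at this⟩
  have hinj : Set.InjOn ρ D := by
    intro x hx y hy hxy
    rcases lt_trichotomy x y with h | h | h
    · exact absurd hxy (hstrict x hx y h).ne
    · exact h
    · exact absurd hxy (hstrict y hy x h).ne'
  have hlt : ∀ x ∈ D, ρ x < #D := fun x hx =>
    card_lt_card ⟨filter_subset _ _, fun h => by simpa using h hx⟩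
  refine ⟨fun x => ρ x / q, fun x y hxy => Nat.div_le_div_right (hmono hxy), fun x hx => ?_, ?_⟩
  · exact (Nat.div_lt_iff_lt_mul hq).2 ((hlt x hx).trans_le hq1)
  · have hblock : ∀ i, #{x ∈ D | ρ x / q = i} ≤ q := fun i => by
      have : #{x ∈ D | ρ x / q = i} ≤ #(Ico (i * q) (i * q + q)) := by
        refine card_le_card_of_injOn ρ (fun x hx => ?_) (hinj.mono fun x hx => ?_)
        · simp only [coe_filter, Set.mem_ofPred_eq] at hx
          obtain ⟨-, rfl⟩ := hx
          simp only [coe_Ico, Set.mem_Ico]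
          exact ⟨Nat.div_mul_le_self _ _, Nat.lt_div_mul_add hq⟩
        · simp only [coe_filter, Set.mem_ofPred_eq] at hx
          exact hx.1
      simpa using this
    have hcount : #{p ∈ D ×ˢ D | ρ p.1 / q = ρ p.2 / q} ≤ #D * q := by
      rw [card_eq_sum_card_fiberwise (f := Prod.fst) (t := D)
        (fun p hp => by simp at hp; exact hp.1.1), ← smul_eq_mul]
      refine sum_le_card_nsmul _ _ _ fun x hx => ?_
      refine le_trans ?_ (hblock (ρ x / q))
      refine card_le_card_of_injOn Prod.snd (fun p hp => ?_) (fun p hp p' hp' h => ?_)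
      · simp only [coe_filter, mem_filter, mem_product, Set.mem_ofPred_eq] at hp ⊢
        exact ⟨hp.1.1.2, by rw [← hp.2, hp.1.2]⟩
      · simp only [coe_filter, mem_filter, mem_product, Set.mem_ofPred_eq] at hp hp'
        exact Prod.ext (hp.2.trans hp'.2.symm) h
    calc r * #{p ∈ D ×ˢ D | ρ p.1 / q = ρ p.2 / q} ≤ r * (#D * q) := Nat.mul_le_mul_left _ hcount
      _ = #D * (r * q) := by ring
      _ ≤ #D * (2 * #D) := Nat.mul_le_mul_left _ hq2
      _ = 2 * #D ^ 2 := by ring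

/-! ### Lines meeting a Cartesian grid -/

/-- The abscissae of the points of the grid `D × D` on the line `y = l.1 * x + l.2`. Since such a
line is not vertical, they are in bijection with the points themselves. -/
noncomputable def gridPoints (D : Finset ℝ) (l : ℝ × ℝ) : Finset ℝ := {x ∈ D | l.1 * x + l.2 ∈ D}

/-- The ordered pairs of distinct points of `D × D` on the line `y = l.1 * x + l.2` that lie in a
common cell, where the cells of the plane are the fibres of `(x, y) ↦ (β x, β y)`. -/
noncomputable def sameCellPairs (β : ℝ → ℕ) (D : Finset ℝ) (l : ℝ × ℝ) : Finset (ℝ × ℝ) :=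
  {p ∈ gridPoints D l ×ˢ gridPoints D l | p.1 ≠ p.2 ∧ β p.1 = β p.2 ∧
    β (l.1 * p.1 + l.2) = β (l.1 * p.2 + l.2)}

/-- Cauchy–Schwarz over the at most `2 r` cells that the line meets. -/
theorem sq_card_gridPoints_le {β : ℝ → ℕ} (hβ : Monotone β) {D : Finset ℝ} {r : ℕ}
    (hr : ∀ x ∈ D, β x < r) {l : ℝ × ℝ} :
    #(gridPoints D l) ^ 2 ≤ 2 * r * (#(sameCellPairs β D l) + #(gridPoints D l)) := by
  set P := gridPoints D l with hP
  have hPD : ∀ x ∈ P, x ∈ D ∧ l.1 * x + l.2 ∈ D := fun x hx => by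
    simpa [hP, gridPoints] using hx
  -- Along the line both block indices are monotone (the second one after reversal if the slope is
  -- negative), so their sum determines the cell.
  obtain ⟨f, hf, hcell⟩ : ∃ f : ℝ → ℕ, (∀ x ∈ P, f x ∈ range (2 * r)) ∧ ∀ x ∈ P, ∀ y ∈ P,
      x ≤ y → f x = f y → β x = β y ∧ β (l.1 * x + l.2) = β (l.1 * y + l.2) := by
    rcases le_total 0 l.1 with hs | hs
    · refine ⟨fun x => β x + β (l.1 * x + l.2), fun x hx => ?_, fun x hx y hy hxy h => ?_⟩
      · have h1 := hr _ (hPD x hx).1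
        have h2 := hr _ (hPD x hx).2
        simp only [mem_range]; omega
      · have h1 := hβ hxy
        have h2 : β (l.1 * x + l.2) ≤ β (l.1 * y + l.2) := hβ (by gcongr)
        simp only at h; omega
    · refine ⟨fun x => β x + (r - β (l.1 * x + l.2)), fun x hx => ?_, fun x hx y hy hxy h => ?_⟩
      · have h1 := hr _ (hPD x hx).1
        have h2 := hr _ (hPD x hx).2
        simp only [mem_range]; omega
      · have h1 := hβ hxy
        have h2 : β (l.1 * y + l.2) ≤ β (l.1 * x + l.2) :=
          hβ (by have := mul_le_mul_of_nonpos_left hxy hs; linarith)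
        have h3 := hr _ (hPD x hx).2
        simp only at h; omega
  have h := sq_card_le_card_mul_card_filter_eq P f (range (2 * r)) hf
  rw [card_range] at h
  refine h.trans (Nat.mul_le_mul_left _ ?_)
  rw [← diag_card P]
  refine (card_le_card fun p hp => ?_).trans (card_union_le _ _)
  simp only [mem_filter, mem_product] at hp
  obtain ⟨⟨h1, h2⟩, h3⟩ := hp
  simp only [mem_union, sameCellPairs, mem_filter, mem_product, mem_diag, ← hP]
  by_cases h12 : p.1 = p.2
  · exact Or.inr ⟨h1, h12⟩
  · refine Or.inl ⟨⟨h1, h2⟩, h12, ?_⟩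
    rcases le_total p.1 p.2 with hle | hle
    · exact hcell _ h1 _ h2 hle h3
    · have := hcell _ h2 _ h1 hle h3.symm
      exact ⟨this.1.symm, this.2.symm⟩

/-- Two distinct points lie on only one of the lines, so the left side counts distinct pairs of
points of `D × D` in a common cell. -/
theorem sum_card_sameCellPairs_le (β : ℝ → ℕ) (D : Finset ℝ) (L : Finset (ℝ × ℝ)) :
    ∑ l ∈ L, #(sameCellPairs β D l) ≤ #{p ∈ D ×ˢ D | β p.1 = β p.2} ^ 2 := by
  rw [← card_sigma, sq, ← card_product]
  refine card_le_card_of_injOn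
    (fun p => (p.2, (p.1.1 * p.2.1 + p.1.2, p.1.1 * p.2.2 + p.1.2))) ?_ ?_
  · rintro ⟨l, x, y⟩ hp
    simp [sameCellPairs, gridPoints] at hp ⊢
    tauto
  · rintro ⟨⟨s, t⟩, x, y⟩ hp ⟨⟨s', t'⟩, x', y'⟩ hp' h
    simp only [Prod.mk.injEq] at h
    obtain ⟨⟨rfl, rfl⟩, h1, h2⟩ := h
    simp [sameCellPairs] at hp
    have hxy : x - y ≠ 0 := sub_ne_zero.2 hp.2.2.1
    have hs : s = s' := mul_right_cancel₀ hxy (by linear_combination h1 - h2)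
    subst hs
    have ht : t = t' := by linarith
    subst ht
    rfl

/-- The number of collinear triples of an `N × N` grid, over lines with at least two points, is
`O(N ^ 4 log N)`. -/
theorem sum_card_gridPoints_cube_le (D : Finset ℝ) (L : Finset (ℝ × ℝ))
    (hL : ∀ l ∈ L, 2 ≤ #(gridPoints D l)) :
    ∑ l ∈ L, (#(gridPoints D l) : ℝ) ^ 3 ≤ 96 * (#D : ℝ) ^ 4 * (1 + Real.log #D) := by
  have hex : ∀ r : ℕ, ∃ β : ℝ → ℕ, r ∈ Icc 1 #D → Monotone β ∧ (∀ x ∈ D, β x < r) ∧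
      r * #{p ∈ D ×ˢ D | β p.1 = β p.2} ≤ 2 * #D ^ 2 := fun r => by
    by_cases hr : r ∈ Icc 1 #D
    · obtain ⟨β, h⟩ := exists_monotone_blocks D r (mem_Icc.1 hr).1 (mem_Icc.1 hr).2
      exact ⟨β, fun _ => h⟩
    · exact ⟨0, fun h => absurd h hr⟩
  choose β hβ using hex
  have hline : ∀ l ∈ L, (#(gridPoints D l) : ℝ) ^ 3 ≤
      24 * ∑ r ∈ Icc 1 #D, (r : ℝ) * #(sameCellPairs (β r) D l) := fun l hl => by
    set m := #(gridPoints D l) with hm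
    have hm2 : 2 ≤ m := hL l hl
    have hmD : m ≤ #D := card_le_card (filter_subset _ _)
    have h1 : (m : ℝ) ^ 2 ≤ 2 * #(sameCellPairs (β 1) D l) := by
      -- With a single block every pair of distinct points counts.
      have h1D : 1 ∈ Icc 1 #D := mem_Icc.2 ⟨le_rfl, by omega⟩
      have hlt := (hβ 1 h1D).2.1
      have : m * m - m ≤ #(sameCellPairs (β 1) D l) := by
        rw [hm, ← offDiag_card]
        refine card_le_card fun p hp => ?_
        simp only [mem_offDiag, gridPoints, mem_filter] at hp
        simp only [sameCellPairs, gridPoints, mem_filter, mem_product]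
        have e1 := hlt _ hp.1.1
        have e2 := hlt _ hp.1.2
        have e3 := hlt _ hp.2.1.1
        have e4 := hlt _ hp.2.1.2
        exact ⟨⟨hp.1, hp.2.1⟩, hp.2.2, by omega, by omega⟩
      have h' : m * m ≤ #(sameCellPairs (β 1) D l) + m := by omega
      have h'' : (m : ℝ) * m ≤ #(sameCellPairs (β 1) D l) + m := by exact_mod_cast h'
      have : (2 : ℝ) ≤ m := by exact_mod_cast hm2
      nlinarith
    -- For `4 r ≤ m` the diagonal term `2 r m` is at most half of `m ^ 2`.
    have hr : ∀ r ∈ Icc 1 (m / 4), (m : ℝ) ^ 2 / 4 ≤ r * #(sameCellPairs (β r) D l) := by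
      intro r hr
      rw [mem_Icc] at hr
      have hrD : r ∈ Icc 1 #D := mem_Icc.2 ⟨hr.1, by omega⟩
      have h := sq_card_gridPoints_le (hβ r hrD).1 (hβ r hrD).2.1 (l := l)
      rw [← hm] at h
      have h' : (m : ℝ) ^ 2 ≤ 2 * r * (#(sameCellPairs (β r) D l) + m) := by exact_mod_cast h
      have h4 : (4 : ℝ) * r ≤ m := by
        have : 4 * r ≤ m := by omega
        exact_mod_cast this
      nlinarith
    have hsum : (m / 4 : ℕ) * ((m : ℝ) ^ 2 / 4) ≤
        ∑ r ∈ Icc 1 #D, (r : ℝ) * #(sameCellPairs (β r) D l) := by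
      have := card_nsmul_le_sum (Icc 1 (m / 4)) _ _ hr
      rw [Nat.card_Icc, nsmul_eq_mul, Nat.add_sub_cancel] at this
      refine this.trans (sum_le_sum_of_subset_of_nonneg (Icc_subset_Icc_right (by omega)) ?_)
      intros; positivity
    have hone : (#(sameCellPairs (β 1) D l) : ℝ) ≤
        ∑ r ∈ Icc 1 #D, (r : ℝ) * #(sameCellPairs (β r) D l) := by
      have := single_le_sum (f := fun r : ℕ => (r : ℝ) * #(sameCellPairs (β r) D l))
        (fun r _ => by positivity) (mem_Icc.2 ⟨le_rfl, by omega⟩ : 1 ∈ Icc 1 #D)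
      simpa using this
    -- The `r = 1` term absorbs the rounding error in `m / 4`.
    have hfloor : (m : ℝ) ≤ 4 * (m / 4 : ℕ) + 4 := by
      have : m ≤ 4 * (m / 4) + 4 := by omega
      exact_mod_cast this
    nlinarith [mul_le_mul_of_nonneg_left hfloor (sq_nonneg (m : ℝ))]
  have hcell : ∀ r ∈ Icc 1 #D, (r : ℝ) * ∑ l ∈ L, (#(sameCellPairs (β r) D l) : ℝ) ≤
      4 * (#D : ℝ) ^ 4 * (r : ℝ)⁻¹ := fun r hr => by
    have h1 : ∑ l ∈ L, (#(sameCellPairs (β r) D l) : ℝ) ≤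
        (#{p ∈ D ×ˢ D | β r p.1 = β r p.2} : ℝ) ^ 2 := by
      exact_mod_cast sum_card_sameCellPairs_le (β r) D L
    have h2 : (r : ℝ) * #{p ∈ D ×ˢ D | β r p.1 = β r p.2} ≤ 2 * (#D : ℝ) ^ 2 := by
      exact_mod_cast (hβ r hr).2.2
    have hr0 : (0 : ℝ) < r := by exact_mod_cast (mem_Icc.1 hr).1
    rw [← div_eq_mul_inv, le_div_iff₀ hr0]
    calc (r : ℝ) * (∑ l ∈ L, (#(sameCellPairs (β r) D l) : ℝ)) * r
        ≤ r * (#{p ∈ D ×ˢ D | β r p.1 = β r p.2} : ℝ) ^ 2 * r := by gcongr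
      _ = (r * #{p ∈ D ×ˢ D | β r p.1 = β r p.2}) ^ 2 := by ring
      _ ≤ (2 * (#D : ℝ) ^ 2) ^ 2 := by gcongr
      _ = 4 * (#D : ℝ) ^ 4 := by ring
  have hharm : ∑ r ∈ Icc 1 #D, (r : ℝ)⁻¹ ≤ 1 + Real.log #D := by
    simpa [harmonic_eq_sum_Icc] using harmonic_le_one_add_log #D
  calc ∑ l ∈ L, (#(gridPoints D l) : ℝ) ^ 3
      ≤ ∑ l ∈ L, 24 * ∑ r ∈ Icc 1 #D, (r : ℝ) * #(sameCellPairs (β r) D l) := sum_le_sum hline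
    _ = 24 * ∑ r ∈ Icc 1 #D, (r : ℝ) * ∑ l ∈ L, (#(sameCellPairs (β r) D l) : ℝ) := by
        rw [← mul_sum, sum_comm]; simp only [mul_sum]
    _ ≤ 24 * ∑ r ∈ Icc 1 #D, 4 * (#D : ℝ) ^ 4 * (r : ℝ)⁻¹ := by
        gcongr 24 * ?_; exact sum_le_sum hcell
    _ = 96 * (#D : ℝ) ^ 4 * ∑ r ∈ Icc 1 #D, (r : ℝ)⁻¹ := by rw [← mul_sum]; ring
    _ ≤ 96 * (#D : ℝ) ^ 4 * (1 + Real.log #D) := by gcongr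

/-! ### Collinear triples and sums of energies -/

/-- The triples `(a, (c₁, c₂))` in `A × (C × C)` with `c₁ ≠ a` and `c₂ ≠ a`. -/
noncomputable def pinnedPairs (A C : Finset ℝ) : Finset (ℝ × ℝ × ℝ) :=
  {t ∈ A ×ˢ C ×ˢ C | t.2.1 ≠ t.1 ∧ t.2.2 ≠ t.1}

/-- The ratio `(c₂ - a) / (c₁ - a)` of a triple `(a, (c₁, c₂))`. -/
noncomputable def pinnedRatio (t : ℝ × ℝ × ℝ) : ℝ := (t.2.2 - t.1) / (t.2.1 - t.1)

/-- Two triples with equal ratios are the abscissae and the ordinates of three points of `D × D`,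
`D = A ∪ C`, on a common line, and the line together with the abscissae determines both triples. -/
theorem card_pinnedRatio_eq_le (A C : Finset ℝ) :
    (#{p ∈ pinnedPairs A C ×ˢ pinnedPairs A C | pinnedRatio p.1 = pinnedRatio p.2} : ℝ) ≤
      96 * (#(A ∪ C) : ℝ) ^ 4 * (1 + Real.log #(A ∪ C)) := by
  set D := A ∪ C with hD
  set Q := {p ∈ pinnedPairs A C ×ˢ pinnedPairs A C | pinnedRatio p.1 = pinnedRatio p.2} with hQ
  -- `σ p` is the slope of the line through `(a, a')` and `(c₁, c₁')`.
  set σ : (ℝ × ℝ × ℝ) × (ℝ × ℝ × ℝ) → ℝ := fun p => (p.2.2.1 - p.2.1) / (p.1.2.1 - p.1.1) with hσ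
  set line : (ℝ × ℝ × ℝ) × (ℝ × ℝ × ℝ) → ℝ × ℝ := fun p => (σ p, p.2.1 - σ p * p.1.1) with hline
  have hmem : ∀ p ∈ Q, (p.1.1 ∈ D ∧ p.1.2.1 ∈ D ∧ p.1.2.2 ∈ D ∧ p.1.2.1 ≠ p.1.1) ∧
      (p.2.1 ∈ D ∧ p.2.2.1 ∈ D ∧ p.2.2.2 ∈ D) ∧
      (line p).1 * p.1.1 + (line p).2 = p.2.1 ∧ (line p).1 * p.1.2.1 + (line p).2 = p.2.2.1 ∧
      (line p).1 * p.1.2.2 + (line p).2 = p.2.2.2 := by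
    rintro ⟨⟨a, c, d⟩, ⟨a', c', d'⟩⟩ hp
    simp only [hQ, pinnedPairs, mem_filter, mem_product] at hp
    obtain ⟨⟨⟨⟨ha, hc, hd⟩, hca, hda⟩, ⟨ha', hc', hd'⟩, hca', hda'⟩, h⟩ := hp
    have h1 : c - a ≠ 0 := sub_ne_zero.2 hca
    have h2 : c' - a' ≠ 0 := sub_ne_zero.2 hca'
    refine ⟨⟨mem_union_left _ ha, mem_union_right _ hc, mem_union_right _ hd, hca⟩,
      ⟨mem_union_left _ ha', mem_union_right _ hc', mem_union_right _ hd'⟩, ?_, ?_, ?_⟩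
    · simp only [hline, hσ]; ring
    · simp only [hline, hσ]; field_simp; ring
    · rw [pinnedRatio, pinnedRatio, div_eq_div_iff h1 h2] at h
      simp only [hline, hσ]; field_simp; linear_combination h
  have hfiber : ∀ l, #{p ∈ Q | line p = l} ≤ #(gridPoints D l) ^ 3 := fun l => by
    have : #{p ∈ Q | line p = l} ≤
        #(gridPoints D l ×ˢ gridPoints D l ×ˢ gridPoints D l) := by
      refine card_le_card_of_injOn Prod.fst (fun p hp => ?_) (fun p hp p' hp' h => ?_)
      · simp only [coe_filter, Set.mem_ofPred_eq] at hp
        obtain ⟨hp, rfl⟩ := hp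
        obtain ⟨h1, h2, e1, e2, e3⟩ := hmem p hp
        simp only [coe_product, Set.mem_prod, mem_coe, gridPoints, mem_filter, e1, e2, e3]
        tauto
      · simp only [coe_filter, Set.mem_ofPred_eq] at hp hp'
        obtain ⟨-, -, e1, e2, e3⟩ := hmem p hp.1
        obtain ⟨-, -, e1', e2', e3'⟩ := hmem p' hp'.1
        rw [hp.2, h] at e1 e2 e3
        rw [hp'.2] at e1' e2' e3'
        exact Prod.ext h (Prod.ext (e1.symm.trans e1')
          (Prod.ext (e2.symm.trans e2') (e3.symm.trans e3')))
    rw [card_product, card_product] at this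
    exact this.trans_eq (by ring)
  have htwo : ∀ l ∈ Q.image line, 2 ≤ #(gridPoints D l) := fun l hl => by
    obtain ⟨p, hp, rfl⟩ := mem_image.1 hl
    obtain ⟨h1, h2, e1, e2, -⟩ := hmem p hp
    refine one_lt_card.2 ⟨p.1.2.1, ?_, p.1.1, ?_, h1.2.2.2⟩
    · simp only [gridPoints, mem_filter, e2]; tauto
    · simp only [gridPoints, mem_filter, e1]; tauto
  refine le_trans ?_ (sum_card_gridPoints_cube_le D (Q.image line) htwo)
  rw [card_eq_sum_card_image line Q]
  exact_mod_cast sum_le_sum fun l _ => hfiber l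

/-- The quadruples with vanishing products number at most `(|B| + |C|) ^ 2`; in the others the
equation `b₁ (c₁ - a) = b₂ (c₂ - a)` can be written as an equality of ratios. -/
theorem mulEnergy_image_sub_le (B C : Finset ℝ) (a : ℝ) :
    mulEnergy B (C.image fun x => x - a) ≤ (#B + #C) ^ 2 +
      #{p ∈ {u ∈ B ×ˢ B | u.1 ≠ 0 ∧ u.2 ≠ 0} ×ˢ {v ∈ C ×ˢ C | v.1 ≠ a ∧ v.2 ≠ a} |
        p.1.1 / p.1.2 = pinnedRatio (a, p.2)} := by
  rw [mulEnergy, ← card_filter_add_card_filter_not (fun x => x.1.1 * x.2.1 = 0)]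
  refine Nat.add_le_add ?_ ?_
  · have hZ : #{z ∈ B ×ˢ C | z.1 * (z.2 - a) = 0} ≤ #B + #C := by
      calc _ ≤ #(B ×ˢ {a} ∪ {0} ×ˢ C) := card_le_card fun z hz => by
            simp only [mem_filter, mem_product, mul_eq_zero, sub_eq_zero] at hz
            simp only [mem_union, mem_product, mem_singleton]
            tauto
        _ ≤ _ := (card_union_le _ _).trans (by simp)
    refine le_trans ?_ (Nat.pow_le_pow_left hZ 2)
    rw [sq, ← card_product]
    refine card_le_card_of_injOn
      (fun x => ((x.1.1, x.2.1 + a), (x.1.2, x.2.2 + a))) ?_ ?_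
    · rintro ⟨⟨b, b'⟩, y, y'⟩ hx
      simp only [coe_filter, mem_filter, mem_product, mem_image, Set.mem_ofPred_eq] at hx
      obtain ⟨⟨⟨⟨hb, hb'⟩, ⟨c, hc, rfl⟩, ⟨c', hc', rfl⟩⟩, h⟩, h0⟩ := hx
      simp only [coe_product, Set.mem_prod, mem_coe, mem_filter, mem_product, sub_add_cancel]
      exact ⟨⟨⟨hb, hc⟩, h0⟩, ⟨hb', hc'⟩, h ▸ h0⟩
    · rintro ⟨⟨b, b'⟩, y, y'⟩ - ⟨⟨d, d'⟩, z, z'⟩ - h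
      simpa [and_assoc, and_left_comm] using h
  · refine card_le_card_of_injOn
      (fun x => ((x.1.1, x.1.2), (x.2.1 + a, x.2.2 + a))) ?_ ?_
    · rintro ⟨⟨b, b'⟩, y, y'⟩ hx
      simp only [coe_filter, mem_filter, mem_product, mem_image, Set.mem_ofPred_eq] at hx
      obtain ⟨⟨⟨⟨hb, hb'⟩, ⟨c, hc, rfl⟩, ⟨c', hc', rfl⟩⟩, h⟩, h0⟩ := hx
      have h0' := h ▸ h0
      simp only [mul_eq_zero, not_or, sub_eq_zero] at h0 h0'
      simp only [coe_filter, mem_filter, mem_product, Set.mem_ofPred_eq, sub_add_cancel]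
      refine ⟨⟨⟨⟨hb, hb'⟩, h0.1, h0'.1⟩, ⟨hc, hc'⟩, h0.2, h0'.2⟩, ?_⟩
      rw [pinnedRatio, div_eq_div_iff h0'.1 (sub_ne_zero.2 h0.2)]
      linear_combination h
    · rintro ⟨⟨b, b'⟩, y, y'⟩ - ⟨⟨d, d'⟩, z, z'⟩ - h
      simpa using h

theorem card_div_eq_div_le_mulEnergy (B : Finset ℝ) :
    #{p ∈ {u ∈ B ×ˢ B | u.1 ≠ 0 ∧ u.2 ≠ 0} ×ˢ {u ∈ B ×ˢ B | u.1 ≠ 0 ∧ u.2 ≠ 0} |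
      p.1.1 / p.1.2 = p.2.1 / p.2.2} ≤ mulEnergy B B := by
  rw [mulEnergy]
  refine card_le_card_of_injOn (fun p => ((p.1.1, p.1.2), (p.2.2, p.2.1))) ?_ ?_
  · rintro ⟨⟨b, b'⟩, d, d'⟩ hp
    simp only [coe_filter, mem_filter, mem_product, Set.mem_ofPred_eq] at hp ⊢
    obtain ⟨⟨⟨⟨hb, hb'⟩, hb0, hb0'⟩, ⟨hd, hd'⟩, hd0, hd0'⟩, h⟩ := hp
    rw [div_eq_div_iff hb0' hd0'] at h
    exact ⟨⟨⟨hb, hb'⟩, hd', hd⟩, by linear_combination h⟩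
  · rintro ⟨⟨b, b'⟩, y, y'⟩ - ⟨⟨d, d'⟩, z, z'⟩ - h
    simp only [Prod.mk.injEq] at h ⊢
    tauto

theorem sum_mulEnergy_image_sub_le (A B C : Finset ℝ) :
    ∑ a ∈ A, (mulEnergy B (C.image fun x => x - a) : ℝ) ≤
      #A * ((#B : ℝ) + #C) ^ 2 + Real.sqrt (mulEnergy B B) *
        Real.sqrt (96 * (#(A ∪ C) : ℝ) ^ 4 * (1 + Real.log #(A ∪ C))) := by
  set U := {u ∈ B ×ˢ B | u.1 ≠ 0 ∧ u.2 ≠ 0} with hU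
  set R := {p ∈ U ×ˢ pinnedPairs A C | p.1.1 / p.1.2 = pinnedRatio p.2} with hR
  have h1 : ∑ a ∈ A, mulEnergy B (C.image fun x => x - a) ≤ #A * (#B + #C) ^ 2 + #R := by
    refine (sum_le_sum fun a _ => mulEnergy_image_sub_le B C a).trans ?_
    rw [sum_add_distrib, sum_const, smul_eq_mul, ← card_sigma]
    refine Nat.add_le_add_left (card_le_card_of_injOn (fun p => (p.2.1, (p.1, p.2.2))) ?_ ?_) _
    · rintro ⟨a, u, v⟩ hp
      simp only [coe_sigma, Set.mem_sigma_iff, mem_coe, mem_filter, mem_product] at hp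
      simp only [hR, hU, pinnedPairs, mem_coe, mem_filter, mem_product]
      tauto
    · rintro ⟨a, u, v⟩ - ⟨a', u', v'⟩ - h
      simp only [Prod.mk.injEq] at h
      obtain ⟨rfl, rfl, rfl⟩ := h
      rfl
  have h2 : (#R : ℝ) ^ 2 ≤ mulEnergy B B *
      (96 * (#(A ∪ C) : ℝ) ^ 4 * (1 + Real.log #(A ∪ C))) := by
    have h := sq_card_filter_eq_le U (pinnedPairs A C) (fun u => u.1 / u.2) pinnedRatio
    have h' := Nat.cast_le (α := ℝ).2 h
    rw [Nat.cast_mul, Nat.cast_pow] at h'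
    refine h'.trans (mul_le_mul ?_ (card_pinnedRatio_eq_le A C) (by positivity) (by positivity))
    exact_mod_cast card_div_eq_div_le_mulEnergy B
  have h3 := Real.le_sqrt_of_sq_le h2
  rw [Real.sqrt_mul (Nat.cast_nonneg _)] at h3
  have h1' : ∑ a ∈ A, (mulEnergy B (C.image fun x => x - a) : ℝ) ≤
      #A * ((#B : ℝ) + #C) ^ 2 + #R := by exact_mod_cast h1
  linarith

theorem mulEnergy_le_sq_mul_sq (B Y : Finset ℝ) : mulEnergy B Y ≤ #B ^ 2 * #Y ^ 2 :=
  (card_filter_le _ _).trans_eq (by simp only [card_product]; ring)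

theorem one_le_logb_card {n : ℕ} (hn : 2 ≤ n) : 1 ≤ Real.logb 2 n := by
  rw [Real.le_logb_iff_rpow_le one_lt_two (by positivity), Real.rpow_one]
  exact_mod_cast hn

theorem one_add_log_le_mul_logb {K : ℝ} (hK : 0 < K) {n m : ℕ} (hn : 2 ≤ n)
    (hm : (m : ℝ) ≤ (1 + K) * n) (hm0 : 0 < m) :
    1 + Real.log m ≤ (2 + K) * Real.logb 2 n := by
  have hn0 : (0 : ℝ) < n := by positivity
  have h1 : Real.log m ≤ Real.log (1 + K) + Real.log n := by
    rw [← Real.log_mul (by positivity) (by positivity)]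
    exact Real.log_le_log (by exact_mod_cast hm0) hm
  have h2 : Real.log (1 + K) ≤ K := by
    have := Real.log_le_sub_one_of_pos (x := 1 + K) (by positivity)
    linarith
  have hL := one_le_logb_card hn
  have h3 : Real.log n ≤ Real.logb 2 n := by
    have h2pos := Real.log_pos one_lt_two
    have h2le : Real.log 2 ≤ 1 := by linarith [Real.log_two_lt_d9]
    rw [Real.logb, le_div_iff₀ h2pos]
    exact mul_le_of_le_one_right (Real.log_nonneg (by exact_mod_cast (by omega : 1 ≤ n))) h2le
  nlinarith

/-- The first part of the theorem: the lower-order terms of `sum_mulEnergy_image_sub_le` are absorbed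
using `|C| ≤ K |A|`. -/
theorem exists_sum_mulEnergy_image_sub_le (K : ℝ) (hK : 0 < K) :
    ∃ c : ℝ, 0 < c ∧ ∀ A B C : Finset ℝ, (#A : ℝ) ≤ K * #C → (#C : ℝ) ≤ K * #A →
      ∑ a ∈ A, (mulEnergy B (C.image fun x => x - a) : ℝ) ≤
        c * (Real.sqrt (mulEnergy B B) * (#A : ℝ) ^ 2 * Real.sqrt (Real.logb 2 #A) +
          (#A : ℝ) ^ 3 + #A * (#B : ℝ) ^ 2) := by
  refine ⟨2 + 2 * K ^ 2 + Real.sqrt (96 * (1 + K) ^ 4 * (2 + K)), by positivity,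
    fun A B C _ hCA => ?_⟩
  set s := Real.sqrt (96 * (1 + K) ^ 4 * (2 + K)) with hs
  have hs0 : 0 ≤ s := Real.sqrt_nonneg _
  obtain hA | hA | hA : #A = 0 ∨ #A = 1 ∨ 2 ≤ #A := by omega
  · rw [card_eq_zero] at hA
    simp [hA]
  · -- The logarithm vanishes here, so the trivial bound on the energy is used.
    obtain ⟨a, rfl⟩ := card_eq_one.1 hA
    simp only [sum_singleton, card_singleton, Nat.cast_one, Real.logb_one, Real.sqrt_zero,
      mul_zero, zero_add, one_pow, one_mul, mul_one] at hCA ⊢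
    have h1 : (mulEnergy B (C.image fun x => x - a) : ℝ) ≤ (#B : ℝ) ^ 2 * (#C : ℝ) ^ 2 := by
      exact_mod_cast (mulEnergy_le_sq_mul_sq _ _).trans
        (Nat.mul_le_mul_left _ (Nat.pow_le_pow_left card_image_le 2))
    have h2 : (#C : ℝ) ^ 2 ≤ K ^ 2 := by gcongr
    nlinarith [mul_le_mul_of_nonneg_left h2 (sq_nonneg (#B : ℝ)), sq_nonneg (#B : ℝ),
      mul_nonneg (sq_nonneg K) (sq_nonneg (#B : ℝ)), mul_nonneg hs0 (sq_nonneg (#B : ℝ)),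
      sq_nonneg K]
  · set n : ℝ := (#A : ℝ) with hn
    set b : ℝ := (#B : ℝ) with hb
    have hn0 : 0 ≤ n := Nat.cast_nonneg _
    have hb0 : 0 ≤ b := Nat.cast_nonneg _
    have hm : (#(A ∪ C) : ℝ) ≤ (1 + K) * n := by
      have : (#(A ∪ C) : ℝ) ≤ n + #C := by
        rw [hn]; exact_mod_cast card_union_le A C
      linarith
    have hm0 : 0 < #(A ∪ C) :=
      (show 0 < #A by omega).trans_le (card_le_card subset_union_left)
    have hlog := one_add_log_le_mul_logb hK hA hm hm0
    have hL := one_le_logb_card hA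
    have hroot : Real.sqrt (96 * (#(A ∪ C) : ℝ) ^ 4 * (1 + Real.log #(A ∪ C))) ≤
        s * (n ^ 2 * Real.sqrt (Real.logb 2 n)) := by
      rw [← Real.sqrt_sq (sq_nonneg n), ← Real.sqrt_mul (by positivity), hs,
        ← Real.sqrt_mul (by positivity)]
      apply Real.sqrt_le_sqrt
      have hlog0 : 0 ≤ 1 + Real.log #(A ∪ C) := by
        have := Real.log_natCast_nonneg #(A ∪ C)
        linarith
      calc 96 * (#(A ∪ C) : ℝ) ^ 4 * (1 + Real.log #(A ∪ C))
          ≤ 96 * ((1 + K) * n) ^ 4 * ((2 + K) * Real.logb 2 n) := by gcongr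
        _ = _ := by ring
    have hfirst : n * (b + #C) ^ 2 ≤ (2 + 2 * K ^ 2) * (n ^ 3 + n * b ^ 2) := by
      have h1 : (b + #C) ^ 2 ≤ (b + K * n) ^ 2 := by gcongr
      have h2 : (b + K * n) ^ 2 ≤ (2 + 2 * K ^ 2) * (n ^ 2 + b ^ 2) := by
        nlinarith [sq_nonneg (b - K * n), sq_nonneg (K * b), sq_nonneg n]
      calc n * (b + #C) ^ 2 ≤ n * ((2 + 2 * K ^ 2) * (n ^ 2 + b ^ 2)) := by
            gcongr; exact h1.trans h2
        _ = _ := by ring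
    have hsecond := mul_le_mul_of_nonneg_left hroot (Real.sqrt_nonneg (mulEnergy B B : ℝ))
    have h := sum_mulEnergy_image_sub_le A B C
    have e1 : 0 ≤ (2 + 2 * K ^ 2) *
        (Real.sqrt (mulEnergy B B) * n ^ 2 * Real.sqrt (Real.logb 2 n)) := by positivity
    have e2 : 0 ≤ s * (n ^ 3 + n * b ^ 2) := by positivity
    linarith

/-! ### Pinned products -/

/-- An upper bound for the sum of the energies `E(A, A - t)` over `|A|` shifts `t` yields a shift for
which the product set `A (A - t)` is large: the shift maximising its size. -/
theorem exists_mem_le_mulEnergy_mul_card_sq {c : ℝ} (hc : 0 < c) {A T : Finset ℝ} (hA : 2 ≤ #A)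
    (hT : #T = #A)
    (h : ∑ t ∈ T, (mulEnergy A (A.image fun x => x - t) : ℝ) ≤
      c * (Real.sqrt (mulEnergy A A) * (#A : ℝ) ^ 2 * Real.sqrt (Real.logb 2 #A) +
        (#A : ℝ) ^ 3 + #A * (#A : ℝ) ^ 2)) :
    ∃ t ∈ T, 1 / (9 * c ^ 2) * ((#A : ℝ) ^ 6 / Real.logb 2 #A) ≤
      mulEnergy A A * (#(A * A.image fun x => x - t) : ℝ) ^ 2 := by
  set n : ℝ := (#A : ℝ) with hn
  set L := Real.logb 2 n with hLdef
  set e := Real.sqrt (mulEnergy A A) with he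
  have hn0 : 0 < n := by rw [hn]; exact_mod_cast (by omega : 0 < #A)
  have hL : 1 ≤ L := one_le_logb_card hA
  have hsL : 1 ≤ Real.sqrt L := Real.one_le_sqrt.2 hL
  have hne : n ≤ e := Real.le_sqrt_of_sq_le (by rw [hn]; exact_mod_cast le_mulEnergy_self (s := A))
  obtain ⟨t, ht, hmax⟩ := exists_max_image T (fun t => #(A * A.image fun x => x - t))
    (card_pos.1 (by omega))
  refine ⟨t, ht, ?_⟩
  set M : ℝ := (#(A * A.image fun x => x - t) : ℝ) with hM
  have hlow : ∀ u ∈ T, n ^ 4 ≤ M * (mulEnergy A (A.image fun x => x - u) : ℝ) := fun u hu => by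
    have h1 := le_card_mul_mul_mulEnergy A (A.image fun x => x - u)
    rw [card_image_of_injective _ (sub_left_injective (b := u))] at h1
    have h2 : n ^ 2 * n ^ 2 ≤ (#(A * A.image fun x => x - u) : ℝ) *
        (mulEnergy A (A.image fun x => x - u) : ℝ) := by
      rw [hn]; exact_mod_cast h1
    have h3 : (#(A * A.image fun x => x - u) : ℝ) ≤ M := by
      rw [hM]; exact_mod_cast hmax u hu
    calc n ^ 4 = n ^ 2 * n ^ 2 := by ring
      _ ≤ _ := h2
      _ ≤ _ := by gcongr
  have hsum : n * n ^ 4 ≤ M * ∑ u ∈ T, (mulEnergy A (A.image fun x => x - u) : ℝ) := by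
    have := card_nsmul_le_sum T _ _ hlow
    rwa [nsmul_eq_mul, hT, ← mul_sum] at this
  have hbound : c * (e * n ^ 2 * Real.sqrt L + n ^ 3 + n * n ^ 2) ≤
      n ^ 2 * (3 * c * (e * Real.sqrt L)) := by
    have : n ≤ e * Real.sqrt L := hne.trans (le_mul_of_one_le_right (hn0.le.trans hne) hsL)
    have := mul_le_mul_of_nonneg_left this (by positivity : 0 ≤ 2 * c * n ^ 2)
    linarith
  have hM0 : 0 ≤ M := Nat.cast_nonneg _
  have hcube : n ^ 3 ≤ 3 * c * (e * Real.sqrt L * M) := by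
    have := hsum.trans (mul_le_mul_of_nonneg_left (h.trans hbound) hM0)
    refine le_of_mul_le_mul_left (a := n ^ 2) ?_ (by positivity)
    linarith
  have hL0 : 0 < L := by linarith
  have hE : e ^ 2 = mulEnergy A A := Real.sq_sqrt (Nat.cast_nonneg _)
  have hsq := pow_le_pow_left₀ (by positivity) hcube 2
  have hsix : n ^ 6 ≤ 9 * c ^ 2 * (mulEnergy A A * M ^ 2 * L) := by
    calc n ^ 6 = (n ^ 3) ^ 2 := by ring
      _ ≤ _ := hsq
      _ = 9 * c ^ 2 * (e ^ 2 * M ^ 2 * Real.sqrt L ^ 2) := by ring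
      _ = _ := by rw [hE, Real.sq_sqrt hL0.le]
  rw [one_div_mul_eq_div, div_le_iff₀ (by positivity), div_le_iff₀ hL0]
  linarith

theorem mainTheorem5 :
    -- the bound for sums of energies with shifts; the constant depends only on `K`,
    -- the constant implied in `|A| ≈ |C|`
    (∀ K : ℝ, 0 < K → ∃ c : ℝ, 0 < c ∧ ∀ A B C : Finset ℝ,
      (A.card : ℝ) ≤ K * (C.card : ℝ) → (C.card : ℝ) ≤ K * (A.card : ℝ) →
        ∑ a ∈ A, (Finset.mulEnergy B (C.image (fun x => x - a)) : ℝ) ≤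
          c * (Real.sqrt (Finset.mulEnergy B B : ℝ) * (A.card : ℝ) ^ 2 *
                Real.sqrt (Real.logb 2 (A.card : ℝ)) +
              (A.card : ℝ) ^ 3 + (A.card : ℝ) * (B.card : ℝ) ^ 2)) ∧
    -- the pinned bounds, with an absolute constant
    (∃ c : ℝ, 0 < c ∧ ∀ A : Finset ℝ, 2 ≤ A.card →
      (∃ a ∈ A, c * ((A.card : ℝ) ^ 6 / Real.logb 2 (A.card : ℝ)) ≤
        (Finset.mulEnergy A A : ℝ) *
          ((A * A.image (fun x => x + a)).card : ℝ) ^ 2) ∧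
      (∃ b ∈ A, c * ((A.card : ℝ) ^ 6 / Real.logb 2 (A.card : ℝ)) ≤
        (Finset.mulEnergy A A : ℝ) *
          ((A * A.image (fun x => x - b)).card : ℝ) ^ 2)) := by
  refine ⟨exists_sum_mulEnergy_image_sub_le, ?_⟩
  obtain ⟨c, hc, h⟩ := exists_sum_mulEnergy_image_sub_le 1 one_pos
  refine ⟨1 / (9 * c ^ 2), by positivity, fun A hA => ⟨?_, ?_⟩⟩
  · -- A shift by `a` is a shift by `-t` with `t = -a` in `-A`.
    have hcard : #(-A) = #A := card_neg A
    have hneg := h (-A) A A (by rw [hcard, one_mul]) (by rw [hcard, one_mul])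
    rw [hcard] at hneg
    obtain ⟨t, ht, hle⟩ := exists_mem_le_mulEnergy_mul_card_sq hc hA hcard hneg
    refine ⟨-t, mem_neg'.1 ht, ?_⟩
    simpa only [sub_eq_add_neg] using hle
  · exact exists_mem_le_mulEnergy_mul_card_sq hc hA rfl
      (h A A A (by rw [one_mul]) (by rw [one_mul]))
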